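/- Let $\mathcal C=\{C_1,\dots,C_m\}$ be a CNF in the Boolean variables $x_1,\dots,x_n$ (each clause $C_i$ is a set of literals), and consider the linear relaxation $(P)$ of its ILP, $$\sum_{x_i\in C}x_i+\sum_{\lnot x_i\in C}(1-x_i)\ \ge\ 1\quad(C\in\mathcal C),\qquad 0\le x_1,\dots,x_n\le 1 .$$ A branch-and-bound tree for this ILP is a rooted binary tree $T$ in which every non-leaf node carries a disjunction $\alpha^\top x\le\delta\ \lor\ \alpha^\top x\ge\delta+1$ with $\alpha\in\mathbb Z^n$, $\delta\in\mathbb Z$, its two outgoing edges being labeled with the two inequalities, such that for every leaf the system consisting of $(P)$ and all inequalities on the path from the root to that leaf has no rational solution. Its size $|T|$ is the number of its leaves. A monotone real circuit with inputs $y_1,\dots,y_m$ is an acyclic directed graph whose gates are either input gates labeled with an input $y_i$, or gates with two ordered incoming edges labeled with a non-decreasing function $\mathbb R^2\to\mathbb R$; one gate is designated as the output, and the size is the number of gates. For a partition $X_0\cup X_1$ of the variables, let $C_i^j$ be the set of literals of $C_i$ whose variable lies in $X_j$. A monotone function $F:\{0,1\}^m\to\{0,1\}$ is an $(X_0,X_1)$-infeasibility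 certificate for $\mathcal C$ if for every $A\subseteq[m]$ (identified with its characteristic vector) $F(A)=0$ implies that $\{C_i^1: i\in[m]\setminus A\}$ is unsatisfiable, and $F(A)=1$ implies that $\{C_i^0: i\in A\}$ is unsatisfiable. **Lemma.** There is a polynomial $p$ with the following property. For every CNF $\mathcal C$ with $m$ clauses in $n$ variables, every partition $X_0\cup X_1$ of its variables, and every branch-and-bound tree $T$ for the ILP of $\mathcal C$, there is a monotone real circuit of size at most $$p\bigl(n+m+|T|\bigr)^{\log_2(n+m+|T|)}$$ that computes an $(X_0,X_1)$-infeasibility certificate for $\mathcal C$. -/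

import Mathlib

/-- A linear inequality `coeff ⬝ x ≤ rhs` with integral data in `n` variables. -/
structure LinIneq (n : ℕ) where
  coeff : Fin n → ℤ
  rhs : ℤ

/-- The point `x` satisfies the inequality. -/
def LinIneq.Holds {n : ℕ} (I : LinIneq n) (x : Fin n → ℚ) : Prop :=
  ∑ i, (I.coeff i : ℚ) * x i ≤ (I.rhs : ℚ)

/-- A finite system `A x ≤ b` of linear inequalities, given by the list of its rows. -/
abbrev LinSystem (n : ℕ) := List (LinIneq n)

/-- There is a rational point satisfying all inequalities of the system. -/
def LPFeasible {n : ℕ} (P : LinSystem n) : Prop :=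
  ∃ x : Fin n → ℚ, ∀ I ∈ P, I.Holds x

/-- Rooted binary trees all of whose internal nodes carry a disjunction
`α ⬝ x ≤ δ ∨ α ⬝ x ≥ δ + 1` with `α` and `δ` integral; `left` is the branch of `α ⬝ x ≤ δ`
and `right` the branch of `α ⬝ x ≥ δ + 1`. -/
inductive BBTree (n : ℕ) : Type
  | leaf : BBTree n
  | node (α : Fin n → ℤ) (δ : ℤ) (left right : BBTree n) : BBTree n

/-- The size of a tree is the number of its leaves. -/
def BBTree.size {n : ℕ} : BBTree n → ℕ
  | .leaf => 1
  | .node _ _ l r => l.size + r.size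

/-- `T.IsTreeFor P`: `T` is a (valid) branch-and-bound tree for the system `P`, i.e. at every leaf
the system consisting of `P` and all edge labels on the path from the root is LP-infeasible.
The label `α ⬝ x ≥ δ + 1` is written as `(-α) ⬝ x ≤ -(δ + 1)`. -/
def BBTree.IsTreeFor {n : ℕ} : BBTree n → LinSystem n → Prop
  | .leaf, P => ¬ LPFeasible P
  | .node α δ l r, P =>
      l.IsTreeFor ({ coeff := α, rhs := δ } :: P) ∧
        r.IsTreeFor ({ coeff := -α, rhs := -(δ + 1) } :: P)

/-- Literals: `(i, true)` is the variable `x_i` and `(i, false)` is its negation. -/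
abbrev Literal (n : ℕ) := Fin n × Bool

/-- A clause is a finite set of literals. -/
abbrev Clause (n : ℕ) := Finset (Literal n)

/-- The assignment `a` satisfies the clause `D`. -/
def Clause.SatBy {n : ℕ} (D : Clause n) (a : Fin n → Bool) : Prop :=
  ∃ l ∈ D, a l.1 = l.2

/-- No assignment satisfies all the clauses in `S`. -/
def Unsatisfiable {n : ℕ} (S : Set (Clause n)) : Prop :=
  ¬ ∃ a : Fin n → Bool, ∀ D ∈ S, D.SatBy a

/-- The part of the clause `D` that contains only variables from `X` and their negations. -/
def Clause.part {n : ℕ} (D : Clause n) (X : Finset (Fin n)) : Clause n :=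
  D.filter (fun l => l.1 ∈ X)

/-- The inequality `∑_{x_i ∈ D} x_i + ∑_{¬ x_i ∈ D} (1 - x_i) ≥ 1`, rewritten in the form
`coeff ⬝ x ≤ rhs`; see `clauseIneq_holds_iff`. -/
def clauseIneq {n : ℕ} (D : Clause n) : LinIneq n where
  coeff i := (if (i, false) ∈ D then 1 else 0) - (if (i, true) ∈ D then 1 else 0)
  rhs := (∑ i : Fin n, if (i, false) ∈ D then 1 else 0) - 1

/-- The LP-relaxation of the ILP of the CNF `{C_1, …, C_m}`: the clause inequalities
together with `0 ≤ x_i` and `x_i ≤ 1` for all variables; see `cnfSystem_holds_iff`. -/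
def cnfSystem {n m : ℕ} (C : Fin m → Clause n) : LinSystem n :=
  List.ofFn (fun j => clauseIneq (C j)) ++
    (List.ofFn (fun i : Fin n => ({ coeff := -Pi.single i 1, rhs := 0 } : LinIneq n)) ++
      List.ofFn (fun i : Fin n => ({ coeff := Pi.single i 1, rhs := 1 } : LinIneq n)))

theorem clauseIneq_holds_iff {n : ℕ} (D : Clause n) (x : Fin n → ℚ) :
    (clauseIneq D).Holds x ↔
      1 ≤ ∑ i with (i, true) ∈ D, x i + ∑ i with (i, false) ∈ D, (1 - x i) := by
  have key : ∑ i with (i, true) ∈ D, x i + ∑ i with (i, false) ∈ D, (1 - x i) =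
      ((clauseIneq D).rhs : ℚ) + 1 - ∑ i, ((clauseIneq D).coeff i : ℚ) * x i := by
    simp only [clauseIneq, Finset.sum_filter]
    push_cast
    rw [sub_add_cancel, ← Finset.sum_add_distrib, ← Finset.sum_sub_distrib]
    refine Finset.sum_congr rfl fun i _ => ?_
    split_ifs <;> ring
  rw [key, LinIneq.Holds]
  constructor <;> intro h <;> linarith

theorem cnfSystem_holds_iff {n m : ℕ} (C : Fin m → Clause n) (x : Fin n → ℚ) :
    (∀ I ∈ cnfSystem C, I.Holds x) ↔
      (∀ j, 1 ≤ ∑ i with (i, true) ∈ C j, x i + ∑ i with (i, false) ∈ C j, (1 - x i)) ∧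
        ∀ i, 0 ≤ x i ∧ x i ≤ 1 := by
  simp only [cnfSystem, List.mem_append, List.mem_ofFn, ← clauseIneq_holds_iff]
  constructor
  · intro h
    refine ⟨fun j => h _ (Or.inl ⟨j, rfl⟩), fun i => ⟨?_, ?_⟩⟩
    · have := h _ (Or.inr (Or.inl ⟨i, rfl⟩))
      simpa [LinIneq.Holds, Pi.single_apply] using this
    · have := h _ (Or.inr (Or.inr ⟨i, rfl⟩))
      simpa [LinIneq.Holds, Pi.single_apply] using this
  · rintro ⟨h1, h2⟩ I (⟨j, rfl⟩ | ⟨i, rfl⟩ | ⟨i, rfl⟩)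
    · exact h1 j
    · simpa [LinIneq.Holds, Pi.single_apply] using (h2 i).1
    · simpa [LinIneq.Holds, Pi.single_apply] using (h2 i).2

/-- `F` is an `(X₀, X₁)`-certificate of infeasibility for the CNF `{C_1, …, C_m}`; a set of indices
of clauses stands for its characteristic vector in `{0,1}^m`, and `false`, `true` for `0`, `1`. -/
def IsInfeasibilityCertificate {n m : ℕ} (C : Fin m → Clause n) (X₀ X₁ : Finset (Fin n))
    (F : Finset (Fin m) → Bool) : Prop :=
  Monotone F ∧ ∀ A : Finset (Fin m),
    (F A = false → Unsatisfiable {D | ∃ i, i ∉ A ∧ D = (C i).part X₁}) ∧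
    (F A = true → Unsatisfiable {D | ∃ i, i ∈ A ∧ D = (C i).part X₀})

/-- A gate with `k` circuit inputs and `j` available predecessors: either an input gate labeled by
a variable, or a fan-in two gate with ordered predecessors `p`, `q` that applies a non-decreasing
function of two real arguments (arbitrary otherwise). -/
inductive MonotoneRealGate (k j : ℕ) : Type
  | input (i : Fin k) : MonotoneRealGate k j
  | op (f : ℝ × ℝ → ℝ) (mono : Monotone f) (p q : Fin j) : MonotoneRealGate k j

/-- A monotone real circuit with `k` inputs. The gates are numbered along a topological order of
the underlying acyclic graph, so that the predecessors of a gate have smaller numbers.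
The size is the number of all gates (input gates included). -/
structure MonotoneRealCircuit (k : ℕ) where
  size : ℕ
  gate : (g : Fin size) → MonotoneRealGate k g.val
  output : Fin size

/-- The value of the gate `g` on the input `x`. -/
noncomputable def MonotoneRealCircuit.value {k : ℕ} (K : MonotoneRealCircuit k) (x : Fin k → ℝ)
    (g : Fin K.size) : ℝ :=
  match K.gate g with
  | .input i => x i
  | .op f _ p q =>
      f (K.value x ⟨p.val, p.isLt.trans g.isLt⟩, K.value x ⟨q.val, q.isLt.trans g.isLt⟩)
termination_by g.val
decreasing_by
  · exact p.isLt
  · exact q.isLt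

/-- The value computed by the circuit on the input `x`. -/
noncomputable def MonotoneRealCircuit.eval {k : ℕ} (K : MonotoneRealCircuit k)
    (x : Fin k → ℝ) : ℝ :=
  K.value x K.output

/-- `K` computes the Boolean function `F`: on every `0/1` input the value is that of `F`. -/
def MonotoneRealCircuit.Computes {m : ℕ} (K : MonotoneRealCircuit m)
    (F : Finset (Fin m) → Bool) : Prop :=
  ∀ A : Finset (Fin m),
    K.eval (fun i => if i ∈ A then 1 else 0) = if F A = true then 1 else 0

/-! Each inequality is split by a number `u` into a condition `I⁰ a + u ≤ 0` on `X₀` and a condition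
`I¹ b ≤ rhs + u` on `X₁`, where `u` depends on the set `A` of clauses. Adding the two gives the
inequality back, so for each `A` at least one half of an infeasible system must fail; the task is to
name such a half by a function monotone in `A`. At a leaf, Farkas weights decide by the sign of the
weighted sum of the `u`'s (`exists_separates_leaf`). At a node, the smaller subtree is queried with
its branching inequality split at various thresholds. Binary search over the at most `2 ^ n` values
on the `X₀` side takes `n + 1` queries and finds a split of the opposite branching inequality that
both halves already imply; the larger subtree is then run once with it (`exists_separates_node`).
Only the smaller subtree is repeated, hence the factor `(n + 2) ^ log₂ |T|`. The obstacle is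
monotonicity: the next threshold decreases with the outcome of the search so far. Tagging every
value lexicographically with that outcome repairs this (`Derivable.lexPair`,
`Derivable.exists_switch`), and a derivation becomes a circuit by `exists_of_derivable`. -/

/-! ### Derivations by non-decreasing steps, and binary search. -/

/-- `Derivable S k f`: the function `f` is obtained from functions in `S` in at most `k` steps, each
of which adds a function that is non-decreasing in two of the functions at hand. -/
inductive Derivable {X : Type*} : Set (X → ℝ) → ℕ → (X → ℝ) → Prop
  | base {S : Set (X → ℝ)} {k : ℕ} {f : X → ℝ} (hf : f ∈ S) : Derivable S k f
  | step {S : Set (X → ℝ)} {k : ℕ} {f : X → ℝ} (p q t : X → ℝ) (hp : p ∈ S) (hq : q ∈ S)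
      (ht : ∀ x y, p x ≤ p y → q x ≤ q y → t x ≤ t y) (hf : Derivable (insert t S) k f) :
      Derivable S (k + 1) f

/-- The value `v` tagged by the natural number `h`: a real that encodes the lexicographic order. -/
noncomputable def lexPair {X : Type*} (h : X → ℕ) (v : X → ℝ) (x : X) : ℝ :=
  h x + Real.sigmoid (v x)

/-- The sigmoid is strictly increasing with values in `(0, 1)`, so it cannot overturn a difference
between integer tags. -/
theorem lexPair_le_iff {X : Type*} (h : X → ℕ) (v : X → ℝ) (x y : X) :
    lexPair h v x ≤ lexPair h v y ↔ h x < h y ∨ h x = h y ∧ v x ≤ v y := by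
  have h1 := Real.sigmoid_pos (v x)
  have h2 := Real.sigmoid_lt_one (v x)
  have h3 := Real.sigmoid_pos (v y)
  have h4 := Real.sigmoid_lt_one (v y)
  unfold lexPair
  rcases lt_trichotomy (h x) (h y) with hlt | heq | hgt
  · have : (h x : ℝ) + 1 ≤ h y := by exact_mod_cast hlt
    simp only [hlt, true_or, iff_true]
    linarith
  · simp [heq, Real.sigmoid_le_iff]
  · have : (h y : ℝ) + 1 ≤ h x := by exact_mod_cast hgt
    have h5 : ¬ h x < h y := by omega
    have h6 : h x ≠ h y := by omega
    simp only [h5, h6, false_and, or_self, iff_false, not_le]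
    linarith

namespace Derivable

variable {X : Type*} {S S' : Set (X → ℝ)} {k k' l : ℕ} {f t : X → ℝ}

theorem mono (h : Derivable S k f) (hS : S ⊆ S') (hk : k ≤ k') : Derivable S' k' f := by
  induction h generalizing S' k' with
  | base hf => exact .base (hS hf)
  | step p q t hp hq ht _ ih =>
    obtain ⟨k', rfl⟩ : ∃ j, k' = j + 1 := ⟨k' - 1, by omega⟩
    exact .step p q t (hS hp) (hS hq) ht (ih (Set.insert_subset_insert hS) (by omega))

theorem trans (h : Derivable S k t) (h' : Derivable (insert t S) l f) :
    Derivable S (k + l) f := by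
  induction h with
  | base hf =>
    rw [Set.insert_eq_of_mem hf] at h'
    exact h'.mono subset_rfl (by omega)
  | @step S k t p q t0 hp hq ht _ ih =>
    rw [Nat.add_right_comm]
    exact .step p q t0 hp hq ht
      (ih (h'.mono (Set.insert_subset_insert (Set.subset_insert _ _)) le_rfl))

theorem step_unary (p : X → ℝ) (hp : p ∈ S) (ht : ∀ x y, p x ≤ p y → t x ≤ t y)
    (hf : Derivable (insert t S) k f) : Derivable S (k + 1) f :=
  .step p p t hp hp (fun x y h _ => ht x y h) hf

theorem step_list (r : List (X → ℝ))
    (hr : ∀ t ∈ r, ∃ p ∈ S, ∃ q ∈ S, ∀ x y, p x ≤ p y → q x ≤ q y → t x ≤ t y)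
    (hf : Derivable (S ∪ {t | t ∈ r}) k f) : Derivable S (k + r.length) f := by
  induction r generalizing S with
  | nil => simpa using hf
  | cons t r ih =>
    obtain ⟨p, hp, q, hq, ht⟩ := hr t (by simp)
    refine .step p q t hp hq ht (ih (fun t' ht' => ?_) (hf.mono ?_ le_rfl))
    · obtain ⟨p, hp, q, hq, h⟩ := hr t' (by simp [ht'])
      exact ⟨p, Or.inr hp, q, Or.inr hq, h⟩
    · rintro v (hv | hv)
      · exact Or.inl (Or.inr hv)
      · rcases List.mem_cons.1 hv with rfl | hv
        · exact Or.inl (Or.inl rfl)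
        · exact Or.inr hv

/-- A strict increase of the tag settles every comparison, and on equal tags the original step
applies. So a derivation from functions that need not be monotone can be replayed on tagged inputs
at no extra cost. -/
theorem lexPair (h : Derivable S k f) (p : X → ℕ) :
    Derivable (_root_.lexPair p '' S) k (_root_.lexPair p f) := by
  induction h with
  | base hf => exact .base ⟨_, hf, rfl⟩
  | step a b t ha hb ht _ ih =>
    rw [Set.image_insert_eq] at ih
    refine .step _ _ _ ⟨a, ha, rfl⟩ ⟨b, hb, rfl⟩ (fun x y hx hy => ?_) ih
    rw [lexPair_le_iff] at *
    rcases hx with hx | ⟨hx, hx'⟩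
    · exact Or.inl hx
    · rcases hy with hy | ⟨hy, hy'⟩
      · exact Or.inl hy
      · exact Or.inr ⟨hx, ht x y hx' hy'⟩

theorem monotone [Preorder X] (h : Derivable S k f) (hS : ∀ v ∈ S, Monotone v) : Monotone f := by
  induction h with
  | base hf => exact hS _ hf
  | step p q t hp hq ht _ ih =>
    refine ih fun v hv => ?_
    rcases hv with rfl | hv
    · exact fun x y hxy => ht x y (hS p hp hxy) (hS q hq hxy)
    · exact hS v hv

theorem weighted_sum {ι : Type*} (u : ι → X → ℝ) (c : ι → ℝ) (hc : ∀ i, 0 ≤ c i)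
    (hu : ∀ i, u i ∈ S) (hS : S.Nonempty) (s : Finset ι) :
    Derivable S (s.card + 1) (fun x => ∑ i ∈ s, c i * u i x) := by
  classical
  induction s using Finset.induction_on with
  | empty =>
    obtain ⟨p, hp⟩ := hS
    exact .step_unary p hp (by simp) (.base (Set.mem_insert _ _))
  | insert i s hi ih =>
    rw [Finset.card_insert_of_notMem hi, Nat.add_right_comm]
    refine ih.trans (.step _ _ _ (Set.mem_insert _ _) (Or.inr (hu i)) (fun x y h1 h2 => ?_)
      (.base (Set.mem_insert _ _)))
    simp only [Finset.sum_insert hi]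
    exact add_le_add (mul_le_mul_of_nonneg_left h2 (hc i)) h1

/-- Binary search: if `P₁ x c` or `P₀ x c` can be decided by a derivable function for every
threshold `c`, then one can derive the index at which a sequence of thresholds switches from
`P₁` to `P₀`. -/
theorem exists_switch (r : List (X → ℝ)) (hr : r ≠ []) (P₀ P₁ : X → ℝ → Prop)
    (hP : ∀ u : X → ℝ, ∃ f, Derivable (insert u {v | v ∈ r}) k f ∧
      ∀ x, f x = 0 ∧ P₀ x (u x) ∨ f x = 1 ∧ P₁ x (u x))
    (d : ℕ) (w : ℕ → ℝ) (hw₁ : ∀ x, P₁ x (w 0)) (hw₀ : ∀ x, P₀ x (w (2 ^ d))) :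
    ∃ p : X → ℕ, Derivable {v | v ∈ r} (d * (k + r.length + 2) + 1) (fun x => (p x : ℝ)) ∧
      ∀ x, P₁ x (w (p x)) ∧ P₀ x (w (p x + 1)) := by
  induction d generalizing w with
  | zero =>
    obtain ⟨a, ha⟩ := List.exists_mem_of_ne_nil r hr
    exact ⟨fun _ => 0, .step_unary a ha (by simp) (.base (Set.mem_insert _ _)),
      fun x => ⟨hw₁ x, hw₀ x⟩⟩
  | succ d ih =>
    -- Search the even thresholds first, then test the odd one between the two found; it varies with
    -- `x`, which is why `hP` allows an arbitrary function `u`.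
    obtain ⟨p, hp, hpw⟩ := ih (fun j => w (2 * j)) hw₁ (by simpa [pow_succ'] using hw₀)
    obtain ⟨f, hf, hfP⟩ := hP (fun x => w (2 * p x + 1))
    refine ⟨fun x => 2 * p x + if f x = 1 then 1 else 0, ?_, fun x => ?_⟩
    · have hlex := hf.lexPair p
      rw [Set.image_insert_eq] at hlex
      refine Derivable.mono (k := (d * (k + r.length + 2) + 1) + (k + 1 + r.length + 1)) ?_
        subset_rfl (by ring_nf; omega)
      refine hp.trans ?_
      -- The threshold itself may decrease in `p`, but its tagged version is a strictly increasing
      -- function of `p`.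
      refine .step_unary _ (Set.mem_insert _ _)
        (t := _root_.lexPair p fun x => w (2 * p x + 1)) (fun x y hxy => ?_) ?_
      · rw [lexPair_le_iff]
        have : p x ≤ p y := (Nat.cast_le (α := ℝ)).1 hxy
        rcases this.lt_or_eq with h | h
        · exact Or.inl h
        · exact Or.inr ⟨h, by rw [h]⟩
      rw [← List.length_map (f := _root_.lexPair p)]
      refine .step_list (r.map (_root_.lexPair p)) (fun t ht => ?_) ?_
      · obtain ⟨v, hv, rfl⟩ := List.mem_map.1 ht
        refine ⟨fun x => p x, by simp, v, Or.inr (Or.inr hv), fun x y h1 h2 => ?_⟩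
        rw [lexPair_le_iff]
        have : p x ≤ p y := (Nat.cast_le (α := ℝ)).1 h1
        rcases this.lt_or_eq with h | h
        · exact Or.inl h
        · exact Or.inr ⟨h, h2⟩
      refine (hlex.mono ?_ le_rfl).trans (.step_unary _ (Set.mem_insert _ _) (fun x y hxy => ?_)
        (.base (Set.mem_insert _ _)))
      · rintro v (rfl | ⟨v, hv, rfl⟩)
        · exact Or.inl (Or.inl rfl)
        · exact Or.inr (List.mem_map_of_mem hv)
      -- The new index `2 * p + f` is non-decreasing in the lexicographic pair `(p, f)` because `f`
      -- is `0` or `1`.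
      · rw [lexPair_le_iff] at hxy
        refine Nat.cast_le.2 ?_
        dsimp only
        rcases hxy with h | ⟨h, h'⟩
        · split_ifs <;> omega
        · split_ifs with h1 h2
          · omega
          · rcases hfP y with h3 | h3
            · rw [h1, h3.1] at h'
              norm_num at h'
            · exact absurd h3.1 h2
          · omega
          · omega
    · have h1 := hpw x
      rcases hfP x with ⟨h2, h3⟩ | ⟨h2, h3⟩
      · simpa [h2] using And.intro h1.1 h3
      · simpa [h2, mul_add] using And.intro h3 h1.2

end Derivable

/-! ### From derivations to monotone real circuits. -/

/-- A map that is non-decreasing in the pair `(p, q)` factors through a non-decreasing function. -/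
theorem exists_monotone_factor {X : Type*} [Finite X] (p q t : X → ℝ)
    (ht : ∀ x y, p x ≤ p y → q x ≤ q y → t x ≤ t y) :
    ∃ g : ℝ × ℝ → ℝ, Monotone g ∧ ∀ x, g (p x, q x) = t x := by
  classical
  rcases isEmpty_or_nonempty X with hX | hX
  · exact ⟨fun _ => 0, fun _ _ _ => le_rfl, fun x => hX.elim x⟩
  obtain ⟨c, hc⟩ := (Set.finite_range t).bddBelow
  -- The factor is the maximum of `t` over the points below `z`; the default `c` is a lower bound of
  -- `t`, so more points can only raise it.
  let F : ℝ × ℝ → X → ℝ := fun z x => if p x ≤ z.1 ∧ q x ≤ z.2 then t x else c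
  have hbdd : ∀ z, BddAbove (Set.range (F z)) := fun z => (Set.finite_range _).bddAbove
  have hct : ∀ x, c ≤ t x := fun x => hc ⟨x, rfl⟩
  refine ⟨fun z => ⨆ x, F z x, fun z z' hz => ciSup_mono (hbdd z') fun x => ?_, fun x => ?_⟩
  · simp only [F]
    split_ifs with h1 h2
    · exact le_rfl
    · exact absurd ⟨h1.1.trans hz.1, h1.2.trans hz.2⟩ h2
    · exact hct x
    · exact le_rfl
  · apply le_antisymm
    · refine ciSup_le fun y => ?_
      simp only [F]
      split_ifs with h
      · exact ht y x h.1 h.2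
      · exact hct x
    · refine le_trans ?_ (le_ciSup (hbdd _) x)
      simp [F]

namespace MonotoneRealCircuit

variable {k : ℕ}

/-- The circuit with one more gate, which becomes the output. -/
def snoc (K : MonotoneRealCircuit k) (g : ℝ × ℝ → ℝ) (hg : Monotone g) (p q : Fin K.size) :
    MonotoneRealCircuit k where
  size := K.size + 1
  gate i :=
    if h : i.val < K.size then K.gate ⟨i.val, h⟩
    else .op g hg ⟨p.val, p.isLt.trans_le (not_lt.1 h)⟩ ⟨q.val, q.isLt.trans_le (not_lt.1 h)⟩
  output := Fin.last K.size

theorem value_snoc_of_lt (K : MonotoneRealCircuit k) (g : ℝ × ℝ → ℝ) (hg : Monotone g)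
    (p q : Fin K.size) (x : Fin k → ℝ) (i : ℕ) (hi : i < K.size) :
    (K.snoc g hg p q).value x ⟨i, Nat.lt_succ_of_lt hi⟩ = K.value x ⟨i, hi⟩ := by
  induction i using Nat.strong_induction_on with
  | _ i ih =>
    have hgate : (K.snoc g hg p q).gate ⟨i, Nat.lt_succ_of_lt hi⟩ = K.gate ⟨i, hi⟩ := by
      simp [snoc, hi]
    rw [value, value, hgate]
    split
    · rfl
    · next f _ a b _ =>
      rw [ih a a.isLt (a.isLt.trans hi), ih b b.isLt (b.isLt.trans hi)]

theorem eval_snoc (K : MonotoneRealCircuit k) (g : ℝ × ℝ → ℝ) (hg : Monotone g)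
    (p q : Fin K.size) (x : Fin k → ℝ) :
    (K.snoc g hg p q).eval x = g (K.value x p, K.value x q) := by
  have hgate : (K.snoc g hg p q).gate (K.snoc g hg p q).output = .op g hg p q := by
    simp [snoc]
  rw [eval, value, hgate]
  simp only
  rw [← K.value_snoc_of_lt g hg p q x p p.isLt, ← K.value_snoc_of_lt g hg p q x q q.isLt]

theorem exists_of_derivable {X : Type*} [Finite X] (z : X → Fin k → ℝ) {S : Set (X → ℝ)} {l : ℕ}
    {f : X → ℝ} (h : Derivable S l f) (K : MonotoneRealCircuit k)
    (hK : ∀ v ∈ S, ∃ g, ∀ x, K.value (z x) g = v x) :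
    ∃ K' : MonotoneRealCircuit k, K'.size ≤ K.size + l + 1 ∧ ∀ x, K'.eval (z x) = f x := by
  induction h generalizing K with
  | base hf =>
    obtain ⟨g, hg⟩ := hK _ hf
    -- A projection gate makes an existing gate the output; this is the `+ 1` in the size.
    refine ⟨K.snoc Prod.fst monotone_fst g g, ?_, fun x => by rw [eval_snoc, hg]⟩
    have : (K.snoc Prod.fst monotone_fst g g).size = K.size + 1 := rfl
    omega
  | step p q t hp hq ht _ ih =>
    obtain ⟨a, ha⟩ := hK p hp
    obtain ⟨b, hb⟩ := hK q hq
    obtain ⟨g, hg, hgt⟩ := exists_monotone_factor p q t ht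
    obtain ⟨K', h1, h2⟩ := ih (K.snoc g hg a b) (by
      rintro v (rfl | hv)
      · exact ⟨(K.snoc g hg a b).output, fun x => by rw [← eval, eval_snoc, ha, hb, hgt]⟩
      · obtain ⟨c, hc⟩ := hK v hv
        exact ⟨c.castSucc, fun x => by rw [← hc, ← K.value_snoc_of_lt g hg a b _ c c.isLt]; rfl⟩)
    refine ⟨K', ?_, h2⟩
    have : (K.snoc g hg a b).size = K.size + 1 := rfl
    omega

/-- The circuit that consists of the input gates. -/
def inputs (hk : 0 < k) : MonotoneRealCircuit k where
  size := k
  gate i := .input i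
  output := ⟨0, hk⟩

theorem value_eq_of_gate_eq_input (K : MonotoneRealCircuit k) (x : Fin k → ℝ) (g : Fin K.size)
    (i : Fin k) (h : K.gate g = .input i) : K.value x g = x i := by
  rw [value, h]

theorem value_inputs (hk : 0 < k) (x : Fin k → ℝ) (i : Fin k) : (inputs hk).value x i = x i :=
  value_eq_of_gate_eq_input (inputs hk) x i i rfl

end MonotoneRealCircuit
-- Farkas' lemma.
/-- **Farkas' lemma** over a linearly ordered field, for finitely many linear functionals. -/
theorem exists_nonneg_combination {R V ι : Type*} [Field R] [LinearOrder R] [IsStrictOrderedRing R]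
    [AddCommGroup V] [Module R V] (s : Finset ι) (a : ι → V →ₗ[R] R) (f : V →ₗ[R] R)
    (h : ∀ x, (∀ i ∈ s, 0 ≤ a i x) → 0 ≤ f x) :
    ∃ c : ι → R, (∀ i, 0 ≤ c i) ∧ ∀ x, f x = ∑ i ∈ s, c i * a i x := by
  classical
  induction s using Finset.induction_on generalizing a f with
  | empty =>
    refine ⟨0, fun _ => le_rfl, fun x => ?_⟩
    have h1 := h x (by simp)
    have h2 := h (-x) (by simp)
    rw [map_neg] at h2
    simp only [Finset.sum_empty]
    linarith
  | insert j s hj ih =>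
    by_cases hs : ∀ x, (∀ i ∈ s, 0 ≤ a i x) → 0 ≤ f x
    · obtain ⟨c, hc, hf⟩ := ih a f hs
      refine ⟨Function.update c j 0, fun i => ?_, fun x => ?_⟩
      · rcases eq_or_ne i j with rfl | hij
        · simp
        · simpa [hij] using hc i
      · rw [Finset.sum_insert hj, hf x, Function.update_self, zero_mul, zero_add]
        refine Finset.sum_congr rfl fun i hi => ?_
        rw [Function.update_of_ne (ne_of_mem_of_not_mem hi hj)]
    · push Not at hs
      obtain ⟨x₀, hx₀, hfx₀⟩ := hs
      have hg : a j x₀ < 0 := by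
        by_contra! hg
        refine hfx₀.not_ge (h x₀ fun i hi => ?_)
        rcases Finset.mem_insert.1 hi with rfl | hi
        · exact hg
        · exact hx₀ i hi
      set e : R := (-a j x₀)⁻¹ with he
      have he0 : 0 < e := inv_pos.2 (by linarith)
      have hea : e * a j x₀ = -1 := by
        rw [he, inv_neg, neg_mul, inv_mul_cancel₀ hg.ne]
      -- Compose all functionals with the projection `x ↦ x + e * a j x • x₀` onto the kernel of `a
      -- j`, where the constraint `j` holds trivially.
      obtain ⟨c, hc, hf⟩ := ih (fun i => a i + (e * a i x₀) • a j) (f + (e * f x₀) • a j)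
        (fun x hx => by
          have := h (x + (e * a j x) • x₀) (fun i hi => by
            rcases Finset.mem_insert.1 hi with rfl | hi
            · rw [map_add, map_smul, smul_eq_mul]
              have : a i x + e * a i x * a i x₀ = a i x * (1 + e * a i x₀) := by ring
              rw [this, hea]
              simp
            · have := hx i hi
              simp only [LinearMap.add_apply, LinearMap.smul_apply, smul_eq_mul] at this
              rw [map_add, map_smul, smul_eq_mul]
              linarith)
          rw [map_add, map_smul, smul_eq_mul] at this
          simp only [LinearMap.add_apply, LinearMap.smul_apply, smul_eq_mul]
          linarith)
      have hd : 0 ≤ e * (∑ i ∈ s, c i * a i x₀ - f x₀) :=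
        mul_nonneg he0.le (sub_nonneg.2 (hfx₀.le.trans
          (Finset.sum_nonneg fun i hi => mul_nonneg (hc i) (hx₀ i hi))))
      refine ⟨Function.update c j (e * (∑ i ∈ s, c i * a i x₀ - f x₀)), fun i => ?_, fun x => ?_⟩
      · rcases eq_or_ne i j with rfl | hij
        · simpa using hd
        · simpa [hij] using hc i
      · have h1 := hf x
        simp only [LinearMap.add_apply, LinearMap.smul_apply, smul_eq_mul, mul_add,
          Finset.sum_add_distrib] at h1
        have h2 : ∑ i ∈ s, c i * (e * a i x₀ * a j x) = e * (∑ i ∈ s, c i * a i x₀) * a j x := by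
          rw [Finset.mul_sum, Finset.sum_mul]
          exact Finset.sum_congr rfl fun i _ => by ring
        have h3 : ∑ i ∈ s, Function.update c j (e * (∑ i ∈ s, c i * a i x₀ - f x₀)) i * a i x =
            ∑ i ∈ s, c i * a i x := Finset.sum_congr rfl fun i hi => by
          rw [Function.update_of_ne (ne_of_mem_of_not_mem hi hj)]
        rw [Finset.sum_insert hj, h3, Function.update_self]
        linear_combination h1 + h2

/-- Farkas' lemma for an infeasible system of linear inequalities. -/
theorem exists_infeasibility_weights {n : ℕ} {ι : Type*} [Fintype ι] (I : ι → LinIneq n)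
    (h : ¬ ∃ x : Fin n → ℚ, ∀ i, (I i).Holds x) :
    ∃ c : ι → ℚ, (∀ i, 0 ≤ c i) ∧ (∀ j, ∑ i, c i * ((I i).coeff j : ℚ) = 0) ∧
      ∑ i, c i * ((I i).rhs : ℚ) < 0 := by
  classical
  -- Homogenization: infeasibility says that the cone of these functionals has no point with `t >
  -- 0`, so `-t` is a nonnegative combination of them.
  let a : Option ι → ((Fin n → ℚ) × ℚ) →ₗ[ℚ] ℚ := fun o => o.elim (LinearMap.snd ℚ _ _) fun i =>
    ((I i).rhs : ℚ) • LinearMap.snd ℚ _ _ -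
      (∑ j, ((I i).coeff j : ℚ) • LinearMap.proj j) ∘ₗ LinearMap.fst ℚ _ _
  have ha : ∀ i (x : Fin n → ℚ) (t : ℚ),
      a (some i) (x, t) = (I i).rhs * t - ∑ j, ((I i).coeff j : ℚ) * x j := by
    intro i x t
    simp [a]
  obtain ⟨c, hc, hf⟩ := exists_nonneg_combination Finset.univ a (-LinearMap.snd ℚ _ _) (by
    rintro ⟨x, t⟩ hx
    have ht : 0 ≤ t := hx none (Finset.mem_univ _)
    by_contra hneg
    have ht' : 0 < t := by
      refine lt_of_le_of_ne ht fun h0 => hneg ?_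
      simp [← h0]
    refine h ⟨fun j => x j / t, fun i => ?_⟩
    have := hx (some i) (Finset.mem_univ _)
    rw [ha] at this
    have h2 : ∑ j, ((I i).coeff j : ℚ) * (x j / t) = (∑ j, ((I i).coeff j : ℚ) * x j) / t := by
      rw [Finset.sum_div]
      exact Finset.sum_congr rfl fun j _ => by ring
    rw [LinIneq.Holds, h2, div_le_iff₀ ht']
    linarith)
  refine ⟨fun i => c (some i), fun i => hc _, fun j => ?_, ?_⟩
  · have := hf (Pi.single j 1, 0)
    simp only [Fintype.sum_option, ha] at this
    simpa [a, Pi.single_apply] using this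
  · have := hf (0, 1)
    simp only [Fintype.sum_option, ha] at this
    simp [a] at this
    have h0 := hc none
    linarith

/-! ### Separating the two halves along a branch-and-bound tree. -/

/-- The part of the left-hand side of `I` at the Boolean point `a` that belongs to the variables
in `Y`. -/
def LinIneq.partialValue {n : ℕ} (I : LinIneq n) (Y : Finset (Fin n)) (a : Fin n → Bool) : ℤ :=
  ∑ i ∈ Y, I.coeff i * if a i then 1 else 0

theorem LinIneq.partialValue_neg {n : ℕ} (α : Fin n → ℤ) (δ ε : ℤ) (Y : Finset (Fin n))
    (a : Fin n → Bool) :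
    LinIneq.partialValue ⟨-α, δ⟩ Y a = - LinIneq.partialValue ⟨α, ε⟩ Y a := by
  simp only [LinIneq.partialValue, Pi.neg_apply, neg_mul, Finset.sum_neg_distrib]

/-- The list `L` of inequalities `I`, each with a function `u`, describes for every `x` the system
of the inequalities `I⁰ a + u x ≤ 0` for the variables in `X₀` and the system of the inequalities
`I¹ b ≤ rhs + u x` for the variables in `X₁`. The function `f` tells which one has no Boolean
solution. -/
def Separates {n : ℕ} {X : Type*} (X₀ X₁ : Finset (Fin n)) (L : List (LinIneq n × (X → ℝ)))
    (f : X → ℝ) : Prop :=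
  ∀ x, f x = 0 ∧ (¬ ∃ b, ∀ q ∈ L, (q.1.partialValue X₁ b : ℝ) ≤ q.1.rhs + q.2 x) ∨
    f x = 1 ∧ ¬ ∃ a, ∀ q ∈ L, (q.1.partialValue X₀ a : ℝ) + q.2 x ≤ 0

section Tree

variable {n : ℕ} {X : Type*} {X₀ X₁ : Finset (Fin n)}

/-- Farkas weights cancel all coefficients, hence also the partial left-hand sides over any set of
variables. What remains of the `X₀` half is `∑ c u ≤ 0`, and of the `X₁` half `0 ≤ ∑ c rhs + ∑ c u`
with `∑ c rhs < 0`; the sign of `∑ c u` refutes one of them. -/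
theorem exists_separates_leaf (L : List (LinIneq n × (X → ℝ))) (hL : ¬ LPFeasible (L.map Prod.fst)) :
    ∃ f, Derivable {v | v ∈ L.map Prod.snd} (L.length + 2) f ∧ Separates X₀ X₁ L f := by
  classical
  have hne : L ≠ [] := by
    rintro rfl
    exact hL ⟨0, by simp⟩
  obtain ⟨c, hc, hcoeff, hrhs⟩ := exists_infeasibility_weights (fun i : Fin L.length => L[i].1) (by
    rintro ⟨x, hx⟩
    refine hL ⟨x, fun I hI => ?_⟩
    obtain ⟨q, hq, rfl⟩ := List.mem_map.1 hI
    obtain ⟨i, hi, rfl⟩ := List.mem_iff_getElem.1 hq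
    exact hx ⟨i, hi⟩)
  have hcR : ∀ i, (0 : ℝ) ≤ c i := fun i => by exact_mod_cast hc i
  have hrhsR : ∑ i : Fin L.length, (c i : ℝ) * (L[i].1.rhs : ℝ) < 0 := by exact_mod_cast hrhs
  have hval : ∀ Y (a : Fin n → Bool),
      ∑ i : Fin L.length, (c i : ℝ) * (L[i].1.partialValue Y a : ℝ) = 0 := by
    intro Y a
    have h1 : ∑ i : Fin L.length, c i * (L[i].1.partialValue Y a : ℚ) = 0 := by
      simp only [LinIneq.partialValue, Int.cast_sum, Int.cast_mul, Finset.mul_sum]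
      rw [Finset.sum_comm]
      refine Finset.sum_eq_zero fun j _ => ?_
      simp only [← mul_assoc]
      rw [← Finset.sum_mul, hcoeff j, zero_mul]
    exact_mod_cast h1
  refine ⟨fun x => if 0 < ∑ i : Fin L.length, (c i : ℝ) * L[i].2 x then 1 else 0, ?_, fun x => ?_⟩
  · have h1 := Derivable.weighted_sum (S := {v | v ∈ L.map Prod.snd}) (fun i : Fin L.length => L[i].2)
      (fun i => (c i : ℝ)) hcR (fun i => List.mem_map_of_mem (List.getElem_mem _))
      (by
        obtain ⟨q, hq⟩ := List.exists_mem_of_ne_nil L hne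
        exact ⟨q.2, List.mem_map_of_mem hq⟩) Finset.univ
    rw [Finset.card_univ, Fintype.card_fin] at h1
    refine h1.trans (.step_unary (k := 0) _ (Set.mem_insert _ _) (fun x y hxy => ?_)
      (.base (Set.mem_insert _ _)))
    split_ifs with h2 h3
    · exact le_rfl
    · exact absurd (h2.trans_le hxy) h3
    · exact zero_le_one
    · exact le_rfl
  · dsimp only
    split_ifs with h
    · refine Or.inr ⟨rfl, ?_⟩
      rintro ⟨a, ha⟩
      have h1 : ∑ i : Fin L.length, (c i : ℝ) * ((L[i].1.partialValue X₀ a : ℝ) + L[i].2 x) ≤ 0 :=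
        Finset.sum_nonpos fun i _ =>
          mul_nonpos_of_nonneg_of_nonpos (hcR i) (ha _ (List.getElem_mem _))
      simp only [mul_add, Finset.sum_add_distrib, hval] at h1
      linarith
    · refine Or.inl ⟨rfl, ?_⟩
      rintro ⟨b, hb⟩
      have h1 : ∑ i : Fin L.length, (c i : ℝ) * (L[i].1.partialValue X₁ b : ℝ) ≤
          ∑ i : Fin L.length, (c i : ℝ) * ((L[i].1.rhs : ℝ) + L[i].2 x) :=
        Finset.sum_le_sum fun i _ => mul_le_mul_of_nonneg_left (hb _ (List.getElem_mem _)) (hcR i)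
      simp only [mul_add, Finset.sum_add_distrib, hval] at h1
      linarith

/-- A decreasing sequence of thresholds that leaves no gap on a finite set of integers. -/
theorem exists_thresholds (N : ℕ) (V : Finset ℤ) (hV : V.card ≤ N) (c₀ c₁ : ℤ)
    (hc : ∀ v ∈ V, v < c₀) :
    ∃ w : ℕ → ℤ, Antitone w ∧ w 0 = c₀ ∧ w (N + 1) ≤ c₁ ∧
      ∀ k, ∀ v ∈ V, v < w k → v ≤ w (k + 1) := by
  have hempty : ∃ w : ℕ → ℤ, Antitone w ∧ w 0 = c₀ ∧ (∀ N, w (N + 1) ≤ c₁) := by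
    refine ⟨fun k => if k = 0 then c₀ else min c₀ c₁, antitone_nat_of_succ_le fun k => ?_, by simp,
      by simp⟩
    simp only [Nat.add_eq_zero_iff, one_ne_zero, and_false, if_false]
    split_ifs <;> simp
  induction N generalizing V c₀ with
  | zero =>
    obtain rfl : V = ∅ := by simpa using hV
    obtain ⟨w, h1, h2, h3⟩ := hempty
    exact ⟨w, h1, h2, h3 _, by simp⟩
  | succ N ih =>
    rcases V.eq_empty_or_nonempty with rfl | hne
    · obtain ⟨w, h1, h2, h3⟩ := hempty
      exact ⟨w, h1, h2, h3 _, by simp⟩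
    -- The thresholds run through `V` in decreasing order: the maximum follows `c₀` and starts the
    -- sequence for the remaining values.
    · obtain ⟨M, hM⟩ : ∃ M, M = V.max' hne := ⟨_, rfl⟩
      have hMV : M ∈ V := hM ▸ V.max'_mem hne
      have hle : ∀ v ∈ V, v ≤ M := fun v hv => hM ▸ V.le_max' v hv
      obtain ⟨w, h1, h2, h3, h4⟩ := ih (V.erase M)
        (by rw [Finset.card_erase_of_mem hMV]; omega) M
        (fun v hv => lt_of_le_of_ne (hle v (Finset.mem_of_mem_erase hv)) (Finset.ne_of_mem_erase hv))
        ⟨fun k => if k = 0 then M else min M c₁, antitone_nat_of_succ_le fun k => by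
          simp only [Nat.add_eq_zero_iff, one_ne_zero, and_false, if_false]
          split_ifs <;> simp, by simp, by simp⟩
      refine ⟨fun k => k.casesOn c₀ w, antitone_nat_of_succ_le fun k => ?_, rfl, h3,
        fun k v hv hvk => ?_⟩
      · cases k with
        | zero => exact h2.le.trans (hc M hMV).le
        | succ k => exact h1 (Nat.le_succ k)
      · cases k with
        | zero => exact (hle v hv).trans h2.ge
        | succ k =>
          refine h4 k v (Finset.mem_erase.2 ⟨?_, hv⟩) hvk
          rintro rfl
          exact absurd hvk (not_lt.2 ((h1 (Nat.zero_le k)).trans h2.le))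

/-- The child queried repeatedly is the one of `h₁`. Querying it at threshold `c` shows either that
`α⁰ a < c` for all solutions of the `X₀` half, or that `α¹ b < δ + 1 - c` for all solutions of the
`X₁` half. Where the answer switches between consecutive thresholds, integrality and the absence of
gaps give `α⁰ a ≤ w (p + 1)` and `α¹ b ≤ δ - w (p + 1)`, which is a split of `α x ≤ δ` for the other
child. -/
theorem exists_separates_node (α : Fin n → ℤ) (δ : ℤ) (L : List (LinIneq n × (X → ℝ)))
    (hL : L ≠ []) (k₁ k₂ : ℕ)
    (h₁ : ∀ u : X → ℝ, ∃ f,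
      Derivable {v | v ∈ ((⟨-α, -(δ + 1)⟩, u) :: L : List (LinIneq n × (X → ℝ))).map Prod.snd} k₁ f ∧
        Separates X₀ X₁ ((⟨-α, -(δ + 1)⟩, u) :: L) f)
    (h₂ : ∀ u : X → ℝ, ∃ f,
      Derivable {v | v ∈ ((⟨α, δ⟩, u) :: L : List (LinIneq n × (X → ℝ))).map Prod.snd} k₂ f ∧
        Separates X₀ X₁ ((⟨α, δ⟩, u) :: L) f) :
    ∃ f, Derivable {v | v ∈ L.map Prod.snd} ((n + 1) * (k₁ + L.length + 2) + 2 + k₂) f ∧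
      Separates X₀ X₁ L f := by
  classical
  have hset : ∀ I : LinIneq n, ∀ u : X → ℝ,
      {v | v ∈ ((I, u) :: L : List (LinIneq n × (X → ℝ))).map Prod.snd} =
        insert u {v | v ∈ L.map Prod.snd} := by
    intro I u
    ext v
    simp
  let A : (Fin n → Bool) → ℤ := LinIneq.partialValue ⟨α, δ⟩ X₀
  let B : (Fin n → Bool) → ℤ := LinIneq.partialValue ⟨α, δ⟩ X₁
  obtain ⟨c₀, hc₀⟩ := (Set.finite_range A).bddAbove
  obtain ⟨c₁, hc₁⟩ := (Set.finite_range B).bddAbove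
  obtain ⟨w, hw, hw0, hwN, hgap⟩ := exists_thresholds (2 ^ n) (Finset.univ.image A)
    (Finset.card_image_le.trans (by simp)) (c₀ + 1) (δ - c₁) (by
      intro v hv
      obtain ⟨a, -, rfl⟩ := Finset.mem_image.1 hv
      exact Int.lt_add_one_iff.2 (hc₀ ⟨a, rfl⟩))
  -- There are up to `2 ^ n + 1` gaps between thresholds, so the search needs `n + 1` rounds.
  have hwN' : w (2 ^ (n + 1)) ≤ δ - c₁ := (hw (by
    have := Nat.one_le_two_pow (n := n)
    rw [pow_succ]
    omega)).trans hwN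
  obtain ⟨p, hp, hpw⟩ := Derivable.exists_switch (k := k₁) (L.map Prod.snd) (by simpa using hL)
    (fun x c => ∀ b, (∀ q ∈ L, (q.1.partialValue X₁ b : ℝ) ≤ q.1.rhs + q.2 x) → (B b : ℝ) < δ + 1 - c)
    (fun x c => ∀ a, (∀ q ∈ L, (q.1.partialValue X₀ a : ℝ) + q.2 x ≤ 0) → (A a : ℝ) < c)
    (fun u => by
      obtain ⟨f, hf, hfs⟩ := h₁ u
      rw [hset] at hf
      refine ⟨f, hf, fun x => ?_⟩
      refine (hfs x).imp (fun h => ⟨h.1, fun b hb => ?_⟩) (fun h => ⟨h.1, fun a ha => ?_⟩)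
      · by_contra! hcon
        refine h.2 ⟨b, List.forall_mem_cons.2 ⟨?_, hb⟩⟩
        rw [LinIneq.partialValue_neg α _ δ]
        push_cast
        simp only [B] at hcon
        linarith
      · by_contra! hcon
        refine h.2 ⟨a, List.forall_mem_cons.2 ⟨?_, ha⟩⟩
        rw [LinIneq.partialValue_neg α _ δ]
        push_cast
        simp only [A] at hcon
        linarith)
    (n + 1) (fun k => (w k : ℝ))
    (fun x a _ => by
      rw [hw0]
      exact_mod_cast Int.lt_add_one_iff.2 (hc₀ ⟨a, rfl⟩))
    (fun x b _ => by
      have h1 : B b ≤ c₁ := hc₁ ⟨b, rfl⟩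
      have h2 : B b < δ + 1 - w (2 ^ (n + 1)) := by linarith
      exact_mod_cast h2)
  obtain ⟨f, hf, hfs⟩ := h₂ fun x => -(w (p x + 1) : ℝ)
  rw [hset] at hf
  refine ⟨f, ?_, fun x => ?_⟩
  · rw [List.length_map] at hp
    refine Derivable.mono (hp.trans (.step_unary _ (Set.mem_insert _ _) (fun x y hxy => ?_)
      (hf.mono (Set.insert_subset_insert (Set.subset_insert _ _)) le_rfl))) subset_rfl (by omega)
    have h1 : p x ≤ p y := (Nat.cast_le (α := ℝ)).1 hxy
    have h2 := hw (Nat.add_le_add_right h1 1)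
    -- The thresholds decrease, so the split value `-w (p + 1)` is non-decreasing in `p`.
    exact neg_le_neg (by exact_mod_cast h2)
  · refine (hfs x).imp (fun h => ⟨h.1, ?_⟩) (fun h => ⟨h.1, ?_⟩)
    · rintro ⟨b, hb⟩
      refine h.2 ⟨b, List.forall_mem_cons.2 ⟨?_, hb⟩⟩
      have h1 := (hpw x).2 b hb
      have h2 : B b < δ + 1 - w (p x + 1) := by exact_mod_cast h1
      have h3 : B b ≤ δ - w (p x + 1) := by omega
      have h4 : (B b : ℝ) ≤ δ - w (p x + 1) := by exact_mod_cast h3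
      simpa [B, sub_eq_add_neg] using h4
    · rintro ⟨a, ha⟩
      refine h.2 ⟨a, List.forall_mem_cons.2 ⟨?_, ha⟩⟩
      have h1 := (hpw x).1 a ha
      have h2 : A a < w (p x) := by exact_mod_cast h1
      have h3 := hgap _ _ (Finset.mem_image_of_mem A (Finset.mem_univ a)) h2
      have h4 : (A a : ℝ) ≤ w (p x + 1) := by exact_mod_cast h3
      simp only [A] at h4
      linarith

theorem BBTree.size_pos {n : ℕ} (T : BBTree n) : 0 < T.size := by
  cases T with
  | leaf => exact Nat.one_pos
  | node α δ l r => exact Nat.add_pos_left (size_pos l) _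

/-- The smaller subtree has at most half of the leaves, so its logarithm leaves room for one more
factor `n + 2`. The summand `K` on the left absorbs the additive costs of the node. -/
theorem size_recurrence_le {n K s₁ s₂ k₁ k₂ d : ℕ} (hs : s₁ ≤ s₂) (hs₁ : 0 < s₁) (hd : d + 2 ≤ K)
    (hk₁ : k₁ + K ≤ 2 * K * s₁ * (n + 2) ^ Nat.log 2 s₁)
    (hk₂ : k₂ + K ≤ 2 * K * s₂ * (n + 2) ^ Nat.log 2 s₂) :
    (n + 1) * (k₁ + d + 2) + 2 + k₂ + K ≤
      2 * K * (s₁ + s₂) * (n + 2) ^ Nat.log 2 (s₁ + s₂) := by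
  have hlog₁ : Nat.log 2 s₁ + 1 ≤ Nat.log 2 (s₁ + s₂) := by
    rw [← Nat.log_mul_base one_lt_two hs₁.ne']
    exact Nat.log_mono_right (by omega)
  have hlog₂ : Nat.log 2 s₂ ≤ Nat.log 2 (s₁ + s₂) := Nat.log_mono_right (by omega)
  calc (n + 1) * (k₁ + d + 2) + 2 + k₂ + K
      ≤ (n + 1) * (k₁ + K) + K + (k₂ + K) := by
        have : (n + 1) * (k₁ + d + 2) ≤ (n + 1) * (k₁ + K) :=
          Nat.mul_le_mul_left _ (by omega)
        omega
    _ ≤ (n + 2) * (k₁ + K) + (k₂ + K) := by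
        have : (n + 2) * (k₁ + K) = (n + 1) * (k₁ + K) + (k₁ + K) := by ring
        omega
    _ ≤ (n + 2) * (2 * K * s₁ * (n + 2) ^ Nat.log 2 s₁) +
          2 * K * s₂ * (n + 2) ^ Nat.log 2 s₂ :=
        Nat.add_le_add (Nat.mul_le_mul_left _ hk₁) hk₂
    _ = 2 * K * s₁ * (n + 2) ^ (Nat.log 2 s₁ + 1) + 2 * K * s₂ * (n + 2) ^ Nat.log 2 s₂ := by ring
    _ ≤ 2 * K * s₁ * (n + 2) ^ Nat.log 2 (s₁ + s₂) +
          2 * K * s₂ * (n + 2) ^ Nat.log 2 (s₁ + s₂) :=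
        Nat.add_le_add (Nat.mul_le_mul_left _ (Nat.pow_le_pow_right (by omega) hlog₁))
          (Nat.mul_le_mul_left _ (Nat.pow_le_pow_right (by omega) hlog₂))
    _ = 2 * K * (s₁ + s₂) * (n + 2) ^ Nat.log 2 (s₁ + s₂) := by ring

/-- Descending an edge adds one inequality and loses at least one leaf, so `K` bounds the length of
the list throughout. -/
theorem exists_separates (K : ℕ) (T : BBTree n)
    (L : List (LinIneq n × (X → ℝ))) (hL : L ≠ []) (hT : T.IsTreeFor (L.map Prod.fst))
    (hK : L.length + T.size + 1 ≤ K) :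
    ∃ k, k + K ≤ 2 * K * T.size * (n + 2) ^ Nat.log 2 T.size ∧
      ∃ f, Derivable {v | v ∈ L.map Prod.snd} k f ∧ Separates X₀ X₁ L f := by
  induction T generalizing L with
  | leaf =>
    simp only [BBTree.size] at hK
    refine ⟨L.length + 2, ?_, exists_separates_leaf L hT⟩
    simp only [BBTree.size, Nat.log_one_right, pow_zero, mul_one]
    omega
  | node α δ l r ihl ihr =>
    have hl := l.size_pos
    have hr := r.size_pos
    simp only [BBTree.size] at hK ⊢
    -- The number of steps from the induction hypothesis may depend on `u`; it is replaced by a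
    -- uniform bound.
    have hbound : ∀ (t : BBTree n) (I : LinIneq n), t.size < l.size + r.size → ∀ ih :
        (∀ L : List (LinIneq n × (X → ℝ)), L ≠ [] → t.IsTreeFor (L.map Prod.fst) →
          L.length + t.size + 1 ≤ K → ∃ k, k + K ≤ 2 * K * t.size * (n + 2) ^ Nat.log 2 t.size ∧
            ∃ f, Derivable {v | v ∈ L.map Prod.snd} k f ∧ Separates X₀ X₁ L f),
        t.IsTreeFor (I :: L.map Prod.fst) →
        ∀ u : X → ℝ, ∃ f,
          Derivable {v | v ∈ ((I, u) :: L : List (LinIneq n × (X → ℝ))).map Prod.snd}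
            (2 * K * t.size * (n + 2) ^ Nat.log 2 t.size - K) f ∧
          Separates X₀ X₁ ((I, u) :: L) f := by
      intro t I ht ih hI u
      obtain ⟨k, hk, f, hf, hfs⟩ := ih ((I, u) :: L) (by simp) hI (by simp; omega)
      exact ⟨f, hf.mono subset_rfl (by omega), hfs⟩
    have hpos : ∀ s, 0 < s → 2 * K * s * (n + 2) ^ Nat.log 2 s - K + K ≤
        2 * K * s * (n + 2) ^ Nat.log 2 s := by
      intro s hs
      refine (Nat.sub_add_cancel ?_).le
      calc K ≤ 2 * K := by omega
        _ ≤ 2 * K * s := Nat.le_mul_of_pos_right _ hs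
        _ ≤ _ := Nat.le_mul_of_pos_right _ (by positivity)
    rcases le_total l.size r.size with h | h
    · refine ⟨_, size_recurrence_le (d := L.length) h hl (by omega) (hpos _ hl) (hpos _ hr), ?_⟩
      -- Negating the disjunction exchanges its sides, so that the left child becomes the repeated
      -- one.
      refine exists_separates_node (-α) (-(δ + 1)) L hL _ _ ?_ ?_
      · have := hbound l ⟨α, δ⟩ (by omega) ihl hT.1
        simpa using this
      · exact hbound r _ (by omega) ihr hT.2
    · refine ⟨_, add_comm l.size r.size ▸
        size_recurrence_le (d := L.length) h hr (by omega) (hpos _ hr) (hpos _ hl), ?_⟩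
      refine exists_separates_node α δ L hL _ _ ?_ ?_
      · exact hbound r _ (by omega) ihr hT.2
      · exact hbound l _ (by omega) ihl hT.1

end Tree
-- Splitting the system of a CNF, and the main theorem.
theorem BBTree.IsTreeFor.not_exists_int {n : ℕ} {T : BBTree n} {P : LinSystem n}
    (h : T.IsTreeFor P) : ¬ ∃ x : Fin n → ℤ, ∀ I ∈ P, I.Holds (fun i => (x i : ℚ)) := by
  induction T generalizing P with
  | leaf => exact fun ⟨x, hx⟩ => h ⟨_, hx⟩
  | node α δ l r ihl ihr =>
    rintro ⟨x, hx⟩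
    rcases le_or_gt (∑ i, α i * x i) δ with hle | hlt
    · refine ihl h.1 ⟨x, List.forall_mem_cons.2 ⟨?_, hx⟩⟩
      rw [LinIneq.Holds]
      exact_mod_cast hle
    · refine ihr h.2 ⟨x, List.forall_mem_cons.2 ⟨?_, hx⟩⟩
      rw [LinIneq.Holds]
      have h1 : ∑ i, (-α) i * x i ≤ -(δ + 1) := by
        simp only [Pi.neg_apply, neg_mul, Finset.sum_neg_distrib]
        omega
      exact_mod_cast h1

/-- The characteristic function of membership of `i`. -/
noncomputable def memIndicator {m : ℕ} (i : Fin m) (A : Finset (Fin m)) : ℝ :=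
  if i ∈ A then 1 else 0

/-- The number of negative literals of `D` with variable in `Y`. -/
def Clause.negCount {n : ℕ} (D : Clause n) (Y : Finset (Fin n)) : ℤ :=
  ∑ i ∈ Y, if (i, false) ∈ D then 1 else 0

/-- The inequalities of `cnfSystem C` together with the functions that split them, for a set `A` of
clauses, into the requirement that `X₀` satisfies the clauses in `A` and the requirement that the
complement of `X₀` satisfies the others. -/
noncomputable def splitCnfSystem {n m : ℕ} (C : Fin m → Clause n) (X₀ : Finset (Fin n)) :
    List (LinIneq n × (Finset (Fin m) → ℝ)) :=
  List.ofFn (fun j => (clauseIneq (C j), fun A => memIndicator j A - (C j).negCount X₀)) ++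
    (List.ofFn (fun i : Fin n => (⟨-Pi.single i 1, 0⟩, fun _ => 0)) ++
      List.ofFn (fun i : Fin n => (⟨Pi.single i 1, 1⟩, fun _ => if i ∈ X₀ then -1 else 0)))

theorem splitCnfSystem_map_fst {n m : ℕ} (C : Fin m → Clause n) (X₀ : Finset (Fin n)) :
    (splitCnfSystem C X₀).map Prod.fst = cnfSystem C := by
  simp [splitCnfSystem, cnfSystem, List.map_ofFn, Function.comp_def]

theorem splitCnfSystem_length {n m : ℕ} (C : Fin m → Clause n) (X₀ : Finset (Fin n)) :
    (splitCnfSystem C X₀).length = m + (n + n) := by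
  simp [splitCnfSystem]

theorem partialValue_single {n : ℕ} (i : Fin n) (δ : ℤ) (Y : Finset (Fin n)) (a : Fin n → Bool) :
    LinIneq.partialValue ⟨Pi.single i 1, δ⟩ Y a = if i ∈ Y ∧ a i then 1 else 0 := by
  simp only [LinIneq.partialValue, Pi.single_apply, ite_mul, one_mul, zero_mul,
    Finset.sum_ite_eq', ite_and]

/-- The difference of the two sides is the number of literals of `D` over `Y` that `a` makes true.
-/
theorem partialValue_clauseIneq_le {n : ℕ} (D : Clause n) (Y : Finset (Fin n)) (a : Fin n → Bool) :
    (clauseIneq D).partialValue Y a ≤ D.negCount Y := by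
  refine Finset.sum_le_sum fun i _ => ?_
  simp only [clauseIneq]
  split_ifs <;> norm_num

theorem partialValue_clauseIneq_lt {n : ℕ} (D : Clause n) (Y : Finset (Fin n)) (a : Fin n → Bool)
    (h : (D.part Y).SatBy a) : (clauseIneq D).partialValue Y a < D.negCount Y := by
  obtain ⟨⟨i, s⟩, hl, hs⟩ := h
  obtain ⟨hD, hY⟩ := Finset.mem_filter.1 hl
  refine Finset.sum_lt_sum (fun i _ => ?_) ⟨i, hY, ?_⟩
  · simp only [clauseIneq]
    split_ifs <;> norm_num
  · simp only [clauseIneq]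
    cases s
    · by_cases h : (i, true) ∈ D <;> simp_all
    · by_cases h : (i, false) ∈ D <;> simp_all

theorem forall_mem_splitCnfSystem {n m : ℕ} (C : Fin m → Clause n) (X₀ : Finset (Fin n))
    (p : LinIneq n × (Finset (Fin m) → ℝ) → Prop) :
    (∀ q ∈ splitCnfSystem C X₀, p q) ↔
      (∀ j, p (clauseIneq (C j), fun A => memIndicator j A - (C j).negCount X₀)) ∧
        (∀ i : Fin n, p (⟨-Pi.single i 1, 0⟩, fun _ => 0)) ∧
          ∀ i : Fin n, p (⟨Pi.single i 1, 1⟩, fun _ => if i ∈ X₀ then -1 else 0) := by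
  simp [splitCnfSystem, or_imp, forall_and, List.mem_ofFn]

theorem isInfeasibilityCertificate_of_separates {n m : ℕ} (C : Fin m → Clause n)
    (X₀ X₁ : Finset (Fin n)) (hd : Disjoint X₀ X₁) (hu : X₀ ∪ X₁ = Finset.univ)
    (f : Finset (Fin m) → ℝ) (hf : Monotone f) (h : Separates X₀ X₁ (splitCnfSystem C X₀) f) :
    IsInfeasibilityCertificate C X₀ X₁ fun A => decide (f A = 1) := by
  have h01 : ∀ A, f A ≤ 1 := fun A => by rcases h A with h | h <;> simp [h.1]
  refine ⟨fun A B hAB => ?_, fun A => ⟨fun hA => ?_, fun hA => ?_⟩⟩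
  · rw [Bool.le_iff_imp]
    simp only [decide_eq_true_eq]
    exact fun hA => le_antisymm (h01 B) (hA ▸ hf hAB)
  · rcases h A with h | h
    · rintro ⟨b, hb⟩
      refine h.2 ⟨b, (forall_mem_splitCnfSystem C X₀ _).2 ⟨fun j => ?_, fun i => ?_, fun i => ?_⟩⟩
      · have hrhs : (clauseIneq (C j)).rhs = (C j).negCount X₀ + (C j).negCount X₁ - 1 := by
          rw [Clause.negCount, Clause.negCount, ← Finset.sum_union hd, hu]
          rfl
        dsimp only
        rw [hrhs]
        unfold memIndicator
        by_cases hj : j ∈ A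
        · have : ((clauseIneq (C j)).partialValue X₁ b : ℝ) ≤ (C j).negCount X₁ := by
            exact_mod_cast partialValue_clauseIneq_le (C j) X₁ b
          simp only [hj, if_true]
          push_cast
          linarith
        · have h1 := partialValue_clauseIneq_lt (C j) X₁ b (hb _ ⟨j, hj, rfl⟩)
          have : ((clauseIneq (C j)).partialValue X₁ b : ℝ) + 1 ≤ (C j).negCount X₁ := by
            exact_mod_cast h1
          simp only [hj, if_false]
          push_cast
          linarith
      · rw [LinIneq.partialValue_neg _ 0 1, partialValue_single]
        split_ifs <;> simp
      · rw [partialValue_single]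
        have : i ∈ X₀ → i ∉ X₁ := fun hi => Finset.disjoint_left.1 hd hi
        split_ifs with h1 h2
        · exact absurd h1.1 (this h2)
        all_goals simp
    · simp [h.1] at hA
  · rcases h A with h | h
    · simp [h.1] at hA
    · rintro ⟨a, ha⟩
      refine h.2 ⟨a, (forall_mem_splitCnfSystem C X₀ _).2 ⟨fun j => ?_, fun i => ?_, fun i => ?_⟩⟩
      · dsimp only
        unfold memIndicator
        by_cases hj : j ∈ A
        · have h1 := partialValue_clauseIneq_lt (C j) X₀ a (ha _ ⟨j, hj, rfl⟩)
          have : ((clauseIneq (C j)).partialValue X₀ a : ℝ) + 1 ≤ (C j).negCount X₀ := by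
            exact_mod_cast h1
          simp only [hj, if_true]
          linarith
        · have : ((clauseIneq (C j)).partialValue X₀ a : ℝ) ≤ (C j).negCount X₀ := by
            exact_mod_cast partialValue_clauseIneq_le (C j) X₀ a
          simp only [hj, if_false]
          linarith
      · rw [LinIneq.partialValue_neg _ 0 1, partialValue_single]
        split_ifs <;> simp
      · rw [partialValue_single]
        split_ifs with h1 h2 h2
        · simp
        · exact absurd h1.1 h2
        all_goals simp

theorem mainTheorem10 :
    ∃ p : Polynomial ℕ,
      ∀ (n m : ℕ) (C : Fin m → Clause n) (X₀ X₁ : Finset (Fin n)),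
        Disjoint X₀ X₁ → X₀ ∪ X₁ = Finset.univ →
        ∀ T : BBTree n, T.IsTreeFor (cnfSystem C) →
          ∃ (F : Finset (Fin m) → Bool) (K : MonotoneRealCircuit m),
            IsInfeasibilityCertificate C X₀ X₁ F ∧ K.Computes F ∧
              (K.size : ℝ) ≤
                ((p.eval (n + m + T.size) : ℕ) : ℝ) ^
                  Real.logb 2 ((n + m + T.size : ℕ) : ℝ) := by
  refine ⟨(2 * Polynomial.X + 1) ^ 2 * (Polynomial.X + 2), fun n m C X₀ X₁ hd hu T hT => ?_⟩
  -- Without clauses the origin is an integral solution, so no tree exists. A circuit needs at least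
  -- one input gate, and constants are derived from it.
  have hm : 0 < m := by
    refine Nat.pos_of_ne_zero fun hm => ?_
    subst hm
    refine hT.not_exists_int ⟨0, (cnfSystem_holds_iff C _).2 ⟨fun j => j.elim0, fun i => ?_⟩⟩
    simp
  have hlen := splitCnfSystem_length C X₀
  obtain ⟨k, hk, f, hf, hfs⟩ := exists_separates (X₀ := X₀) (X₁ := X₁) (m + (n + n) + T.size + 1) T
    (splitCnfSystem C X₀) (List.length_pos_iff.1 (by omega))
    ((splitCnfSystem_map_fst C X₀).symm ▸ hT) (by omega)
  have hf' : Derivable (Set.range (memIndicator (m := m)))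
      (k + ((splitCnfSystem C X₀).map Prod.snd).length) f := by
    refine .step_list _ (fun t ht => ?_) (hf.mono Set.subset_union_right le_rfl)
    obtain ⟨q, hq, rfl⟩ := List.mem_map.1 ht
    refine (forall_mem_splitCnfSystem C X₀ (fun q => ∃ p ∈ Set.range (memIndicator (m := m)),
      ∃ p' ∈ Set.range (memIndicator (m := m)),
        ∀ x y, p x ≤ p y → p' x ≤ p' y → q.2 x ≤ q.2 y)).2 ⟨fun j => ?_, fun i => ?_, fun i => ?_⟩ q hq
    · exact ⟨_, ⟨j, rfl⟩, _, ⟨j, rfl⟩, fun x y h _ => sub_le_sub_right h _⟩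
    · exact ⟨_, ⟨⟨0, hm⟩, rfl⟩, _, ⟨⟨0, hm⟩, rfl⟩, fun x y _ _ => le_rfl⟩
    · exact ⟨_, ⟨⟨0, hm⟩, rfl⟩, _, ⟨⟨0, hm⟩, rfl⟩, fun x y _ _ => le_rfl⟩
  have hmono : Monotone f := hf'.monotone (by
    rintro v ⟨i, rfl⟩ A B hAB
    unfold memIndicator
    split_ifs with h1 h2
    · exact le_rfl
    · exact absurd (hAB h1) h2
    · exact zero_le_one
    · exact le_rfl)
  obtain ⟨K, hK, hKf⟩ := MonotoneRealCircuit.exists_of_derivable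
    (fun (A : Finset (Fin m)) i => memIndicator i A) hf' (MonotoneRealCircuit.inputs hm) (by
      rintro v ⟨i, rfl⟩
      exact ⟨i, fun A => MonotoneRealCircuit.value_inputs hm _ i⟩)
  refine ⟨_, K, isInfeasibilityCertificate_of_separates C X₀ X₁ hd hu f hmono hfs, fun A => ?_, ?_⟩
  · refine (hKf A).trans ?_
    rcases hfs A with h | h <;> simp [h.1]
  · have hs := T.size_pos
    set s := T.size
    set N := n + m + s with hN
    have hsize : K.size ≤ (2 * N + 1) ^ 2 * (N + 2) ^ Nat.log 2 N := by
      have h1 : (MonotoneRealCircuit.inputs hm).size = m := rfl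
      rw [h1, List.length_map, hlen] at hK
      have h2 : (n + 2) ^ Nat.log 2 s ≤ (N + 2) ^ Nat.log 2 N :=
        (Nat.pow_le_pow_left (by omega) _).trans
          (Nat.pow_le_pow_right (by omega) (Nat.log_mono_right (by omega)))
      have h3 : 2 * (m + (n + n) + s + 1) * s ≤ 2 * (2 * N + 1) * N :=
        Nat.mul_le_mul (by omega) (by omega)
      have h4 := Nat.mul_le_mul h3 h2
      have h5 : 1 ≤ (N + 2) ^ Nat.log 2 N := Nat.one_le_pow _ _ (by omega)
      have h6 := Nat.mul_le_mul_left (2 * N + 1) h5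
      calc K.size ≤ 2 * (2 * N + 1) * N * (N + 2) ^ Nat.log 2 N +
            (2 * N + 1) * (N + 2) ^ Nat.log 2 N := by omega
        _ = _ := by ring
    -- Both `m` and `s` are positive, so `N ≥ 2`; the exponent is at least `1` and the factor `(2 *
    -- N + 1) ^ 2` can be moved under it.
    have hN1 : (1 : ℝ) ≤ Real.logb 2 N := by
      rw [Real.le_logb_iff_rpow_le one_lt_two (by exact_mod_cast (by omega : 0 < N)), Real.rpow_one]
      exact_mod_cast (by omega : 2 ≤ N)
    have hlog : ((Nat.log 2 N : ℕ) : ℝ) ≤ Real.logb 2 N := Real.natLog_le_logb _ _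
    have heval : (Polynomial.eval N ((2 * Polynomial.X + 1) ^ 2 * (Polynomial.X + 2)) : ℕ) =
        (2 * N + 1) ^ 2 * (N + 2) := by
      simp
    rw [heval]
    have hbase : (1 : ℝ) ≤ (2 * N + 1) ^ 2 :=
      one_le_pow₀ (by linarith [Nat.cast_nonneg (α := ℝ) N])
    calc (K.size : ℝ) ≤ (2 * N + 1) ^ 2 * (N + 2) ^ Nat.log 2 N := by exact_mod_cast hsize
      _ ≤ ((2 * N + 1) ^ 2 : ℝ) ^ Real.logb 2 N * (N + 2 : ℝ) ^ Real.logb 2 N := by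
        refine mul_le_mul ?_ ?_ (by positivity) (by positivity)
        · exact (Real.rpow_one _).symm.le.trans (Real.rpow_le_rpow_of_exponent_le hbase hN1)
        · rw [← Real.rpow_natCast]
          exact Real.rpow_le_rpow_of_exponent_le
            (by linarith [Nat.cast_nonneg (α := ℝ) N]) hlog
      _ = ((2 * N + 1) ^ 2 * (N + 2) : ℝ) ^ Real.logb 2 N :=
        (Real.mul_rpow (by positivity) (by positivity)).symm
      _ = _ := by push_cast; rfl
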